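/- Let $n\ge 2$ and $m>(2+\sqrt 2)(2n-1)$ be integers. Then there are positive real numbers $\lambda_{q,p}$ $(1\le q\le m,\ 1\le p\le n)$ and continuous, strictly increasing functions $\phi_1,\ldots,\phi_m\colon\mathbb{R}\to\mathbb{R}$ with the following property: for every bounded continuous function $f\colon\mathbb{R}^n\to\mathbb{R}$ there is a continuous function $g\colon\mathbb{R}\to\mathbb{R}$ such that $$f(x)=\sum_{q=1}^m g\left(\sum_{p=1}^n \lambda_{q,p}\,\phi_q(x_p)\right)$$ for every $x=(x_1,\ldots,x_n)\in\mathbb{R}^n$. -/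

import Mathlib

/-!
The weights are chosen independent of `q`, and the proof only needs `m ≥ 4 * n + 3`, which the
hypothesis on `m` implies. Two properties of the inner functions `Φ_q x = ∑ p, lam p * φ q (x p)`
carry the argument.

*Growth.* Each `φ q` stays within distance `1` of the function `kink q`, which has slope `1` on the
positive and slope `1 + q` on the negative half-line. Up to a bounded error `Φ_q x` is then
`A + q * B`, where `A = ∑ p, lam p * x p` and `B = ∑ p, lam p * min (x p) 0`. Two such numbers with
different `q` can both be small only if `A` and `B` are, that is, only if `x` is. Hence `|Φ_q x|` is
comparable to the norm of `x` for all `q` but at most one (`eq_of_innerSum_small`).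

*Separation.* On every cube and for every `δ`, there are disjoint sets of gaps in the line, one for
each `q`, such that points whose coordinates avoid the gaps are determined up to `δ` by the value of
their inner function (`Separates`). This holds for generic tuples `φ` in the topology of locally
uniform convergence: staircases with steps in `mu q * ℚ` have the property when the numbers
`lam p * mu q` are linearly independent over `ℚ`, it is open, and staircases are dense
(`exists_strictMono_separates`).

Given a bounded continuous `f`, cut the line of values into bands of geometrically growing size,
and for each band use the gaps of a scale so fine that `f` is nearly constant at that scale on all
of the points whose size is comparable to the band. By the growth property the values `Φ_q x` of
one point `x` meet only two consecutive bands, apart from the one exceptional `q`. So all but at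
most `2 * n + 1` of the indices are good at `x` (`card_uncontrolled_le`): the outer function may be
prescribed to be about `f x / m` at `Φ_q x`. If `f` is bounded by `M`, the error is at most about
`(2 * n + 1) * (2 * M / m)`, which is smaller than `M` (`exists_outer_reducing`). Iteration gives an
exact representation (`exists_outer_eq`).
-/

open Set Filter Topology

/-! ### Representation by one outer function -/

/-- The inner function `x ↦ ∑ p, lam p * φ (x p)` of a superposition. -/
def innerSum {n : ℕ} (lam : Fin n → ℝ) (φ : ℝ → ℝ) (x : Fin n → ℝ) : ℝ :=
  ∑ p, lam p * φ (x p)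

/-- The sets `G q` are pairwise disjoint, and the points of the cube `[-R, R]ⁿ` whose coordinates
all avoid `G q` are resolved up to `δ` by the value of the `q`-th inner function: two such points,
possibly for different indices, at which the inner functions differ by less than `η` have sup
distance at most `δ`. The sets `G q` are to be thought of as the thin gaps between the intervals
on which `φ q` is nearly constant. -/
def Separates {n m : ℕ} (lam : Fin n → ℝ) (φ : Fin m → ℝ → ℝ) (R δ η : ℝ)
    (G : Fin m → Set ℝ) : Prop :=
  (∀ q q' s, s ∈ G q → s ∈ G q' → q = q') ∧
    ∀ q q' (x y : Fin n → ℝ), (∀ p, |x p| ≤ R ∧ x p ∉ G q) → (∀ p, |y p| ≤ R ∧ y p ∉ G q') →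
      |innerSum lam (φ q) x - innerSum lam (φ q') y| < η → dist x y ≤ δ

/-- Every point is controlled by all but at most `2 * n + 1` of the indices `q`. Here `a q` is the
size of the `q`-th inner function at a point of size `u`, the gaps are taken at the scales `j`
whose band `(K ^ j / 2, K ^ (j + 1))` contains `a q`, and `C` is the growth constant. One index
is lost to the growth condition; the remaining ones see only two consecutive scales, and each
coordinate lies in at most one gap for each of them. -/
lemma card_uncontrolled_le {n m : ℕ} {C K u : ℝ} (hC : 1 ≤ C) (hK : 2 * C ^ 2 < K) (hu : 1 ≤ u)
    (a : Fin m → ℝ) (ha : ∀ q, a q ≤ C * u)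
    (ha' : ∀ q q', C * a q < u → C * a q' < u → q = q')
    (x : Fin n → ℝ) (G : ℕ → Fin m → Set ℝ)
    (hG : ∀ j q q' s, s ∈ G j q → s ∈ G j q' → q = q')
    (B : Finset (Fin m))
    (hB : ∀ q ∈ B, u ≤ C * a q → ∃ j, K ^ j / 2 < a q ∧ a q < K ^ (j + 1) ∧ ∃ p, x p ∈ G j q) :
    B.card ≤ 2 * n + 1 := by
  classical
  have hK1 : 1 < K := by nlinarith
  obtain ⟨i, hi1, hi2⟩ := exists_nat_pow_near (x := 2 * C * u) (y := K) (by nlinarith) hK1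
  have hsub : B ⊆ (Finset.univ.filter fun q => C * a q < u) ∪
      Finset.univ.biUnion fun p : Fin n => (Finset.univ.filter fun q => x p ∈ G i q) ∪
        Finset.univ.filter fun q => x p ∈ G (i - 1) q := by
    intro q hq
    simp only [Finset.mem_union, Finset.mem_filter, Finset.mem_univ, true_and,
      Finset.mem_biUnion]
    rcases lt_or_ge (C * a q) u with h | h
    · exact Or.inl h
    · obtain ⟨j, hj1, hj2, p, hp⟩ := hB q hq h
      refine Or.inr ⟨p, ?_⟩
      have h1 : K ^ j < K ^ (i + 1) := by nlinarith [ha q]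
      have h1' : j < i + 1 := (pow_lt_pow_iff_right₀ hK1).1 h1
      have h2 : K ^ i < K ^ (j + 2) := by
        have : u < C * K ^ (j + 1) := by nlinarith
        have hpos : 0 < K ^ (j + 1) := by positivity
        calc K ^ i ≤ 2 * C * u := hi1
          _ < 2 * C * (C * K ^ (j + 1)) := by gcongr
          _ = (2 * C ^ 2) * K ^ (j + 1) := by ring
          _ < K * K ^ (j + 1) := by gcongr
          _ = K ^ (j + 2) := by ring
      have h2' : i < j + 2 := (pow_lt_pow_iff_right₀ hK1).1 h2
      have : j = i ∨ j = i - 1 := by omega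
      rcases this with rfl | rfl
      · exact Or.inl hp
      · exact Or.inr hp
  refine (Finset.card_le_card hsub).trans ((Finset.card_union_le _ _).trans ?_)
  have h1 : (Finset.univ.filter fun q => C * a q < u).card ≤ 1 := by
    rw [Finset.card_le_one]
    intro q hq q' hq'
    simp only [Finset.mem_filter, Finset.mem_univ, true_and] at hq hq'
    exact ha' q q' hq hq'
  have h2 : ∀ j p, (Finset.univ.filter fun q => x p ∈ G j q).card ≤ 1 := by
    intro j p
    rw [Finset.card_le_one]
    intro q hq q' hq'
    simp only [Finset.mem_filter, Finset.mem_univ, true_and] at hq hq'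
    exact hG j q q' _ hq hq'
  have h3 := Finset.card_biUnion_le_card_mul (Finset.univ : Finset (Fin n))
    (fun p : Fin n => (Finset.univ.filter fun q => x p ∈ G i q) ∪
        Finset.univ.filter fun q => x p ∈ G (i - 1) q) 2
    (fun p _ => (Finset.card_union_le _ _).trans (by linarith [h2 i p, h2 (i - 1) p]))
  simp only [Finset.card_univ, Fintype.card_fin] at h3
  linarith

/-- A single outer function reduces the sup norm of a bounded continuous function by the factor
`(8 * n + 5) / (2 * m)`. The outer function is chosen close to `f / m` on the values of the
inner functions at controlled points; by separation this prescription is locally consistent. -/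
lemma exists_outer_reducing {n m : ℕ} (hm : 4 * n + 3 ≤ m) {lam : Fin n → ℝ}
    {φ : Fin m → ℝ → ℝ} {C : ℝ} (hC : 1 ≤ C)
    (hup : ∀ q x, 1 + |innerSum lam (φ q) x| ≤ C * (1 + ‖x‖))
    (hlow : ∀ x q q', C * (1 + |innerSum lam (φ q) x|) < 1 + ‖x‖ →
      C * (1 + |innerSum lam (φ q') x|) < 1 + ‖x‖ → q = q')
    (hsep : ∀ R δ : ℝ, 0 < δ → ∃ η > 0, ∃ G, Separates lam φ R δ η G)
    {f : (Fin n → ℝ) → ℝ} (hf : Continuous f) {M : ℝ} (hM : 0 < M) (hfM : ∀ x, |f x| ≤ M) :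
    ∃ g : ℝ → ℝ, Continuous g ∧ (∀ t, |g t| ≤ M) ∧
      ∀ x, |f x - ∑ q, g (innerSum lam (φ q) x)| ≤ (8 * n + 5) / (2 * m) * M := by
  classical
  have hm0 : (0 : ℝ) < m := by
    have : 0 < m := by omega
    exact_mod_cast this
  have hm1 : (1 : ℝ) ≤ m := by
    have : 1 ≤ m := by omega
    exact_mod_cast this
  set K : ℝ := 2 * C ^ 2 + 1 with hKdef
  have hK : 2 * C ^ 2 < K := by linarith
  have hK1 : 1 < K := by nlinarith
  -- On the ball seen by the band of index `j`, `f` varies by at most `M / (2m)` at distance `δ j`.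
  have hunif : ∀ j : ℕ, ∃ δ > 0, ∀ x y : Fin n → ℝ, ‖x‖ ≤ C * K ^ (j + 1) →
      ‖y‖ ≤ C * K ^ (j + 1) → dist x y ≤ δ → |f x - f y| ≤ M / (2 * m) := by
    intro j
    have hu := (isCompact_closedBall (0 : Fin n → ℝ)
      (C * K ^ (j + 1))).uniformContinuousOn_of_continuous hf.continuousOn
    rw [Metric.uniformContinuousOn_iff] at hu
    obtain ⟨δ, hδ, h⟩ := hu (M / (2 * m)) (by positivity)
    refine ⟨δ / 2, by positivity, fun x y hx hy hxy => ?_⟩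
    have := h x (by simpa using hx) y (by simpa using hy) (by linarith)
    rw [Real.dist_eq] at this
    exact this.le
  choose δ hδ hδf using hunif
  choose η hη G hG using fun j : ℕ => hsep (C * K ^ (j + 1)) (δ j) (hδ j)
  -- `Good q x` means that the value of the outer function at `innerSum lam (φ q) x` is prescribed.
  let Good : Fin m → (Fin n → ℝ) → Prop := fun q x =>
    1 + ‖x‖ ≤ C * (1 + |innerSum lam (φ q) x|) ∧
      ∀ j : ℕ, K ^ j / 2 < 1 + |innerSum lam (φ q) x| →
        1 + |innerSum lam (φ q) x| < K ^ (j + 1) → ∀ p, x p ∉ G j q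
  -- `t y` is the convex set of admissible values of the outer function at `y`.
  let t : ℝ → Set ℝ := fun y => Metric.closedBall 0 (M / m) ∩
    ⋂ q, ⋂ x, ⋂ (_ : Good q x ∧ innerSum lam (φ q) x = y),
      Metric.closedBall (f x / m) (M / (2 * m ^ 2))
  have htconv : ∀ y, Convex ℝ (t y) := fun y =>
    (convex_closedBall _ _).inter <| convex_iInter fun q => convex_iInter fun x =>
      convex_iInter fun _ => convex_closedBall _ _
  have htloc : ∀ y, ∃ c, ∀ᶠ y' in 𝓝 y, c ∈ t y' := by
    intro y
    obtain ⟨j, hj1, hj2⟩ := exists_nat_pow_near (x := 1 + |y|) (y := K)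
      (by linarith [abs_nonneg y]) hK1
    have hKj : 0 < K ^ j := by positivity
    have hev : ∀ᶠ y' in 𝓝 y, K ^ j / 2 < 1 + |y'| ∧ 1 + |y'| < K ^ (j + 1) ∧
        |y' - y| < η j / 2 := by
      have hc : Continuous fun y' : ℝ => 1 + |y'| := by fun_prop
      refine (hc.continuousAt.eventually (lt_mem_nhds (by linarith))).and
        ((hc.continuousAt.eventually (gt_mem_nhds hj2)).and ?_)
      exact Metric.eventually_nhds_iff.2 ⟨η j / 2, half_pos (hη j), fun z hz => by
        rwa [Real.dist_eq] at hz⟩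
    have hball : ∀ q x, Good q x → 1 + |innerSum lam (φ q) x| < K ^ (j + 1) →
        ‖x‖ ≤ C * K ^ (j + 1) := by
      intro q x hx h
      have := hx.1
      nlinarith
    by_cases hex : ∃ y' q x, (K ^ j / 2 < 1 + |y'| ∧ 1 + |y'| < K ^ (j + 1) ∧
        |y' - y| < η j / 2) ∧ Good q x ∧ innerSum lam (φ q) x = y'
    · obtain ⟨y₁, q₁, x₁, ⟨h1, h2, h3⟩, hg₁, rfl⟩ := hex
      refine ⟨f x₁ / m, hev.mono fun y' hy' => ⟨?_, ?_⟩⟩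
      · rw [mem_closedBall_zero_iff, Real.norm_eq_abs, abs_div, abs_of_pos hm0]
        gcongr
        exact hfM x₁
      · simp only [mem_iInter]
        rintro q x ⟨hg, rfl⟩
        have hd : dist x₁ x ≤ δ j := by
          refine (hG j).2 q₁ q x₁ x (fun p => ⟨?_, hg₁.2 j h1 h2 p⟩)
            (fun p => ⟨?_, hg.2 j hy'.1 hy'.2.1 p⟩) ?_
          · exact (norm_le_pi_norm x₁ p).trans (hball q₁ x₁ hg₁ h2)
          · exact (norm_le_pi_norm x p).trans (hball q x hg hy'.2.1)
          · have h4 := hy'.2.2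
            rw [abs_lt] at h3 h4 ⊢
            constructor <;> linarith
        have hfd := hδf j x₁ x (hball q₁ x₁ hg₁ h2) (hball q x hg hy'.2.1) hd
        rw [Metric.mem_closedBall, Real.dist_eq, ← sub_div, abs_div, abs_of_pos hm0]
        calc |f x₁ - f x| / m ≤ M / (2 * m) / m := by gcongr
          _ = M / (2 * m ^ 2) := by field_simp
    · refine ⟨0, hev.mono fun y' hy' => ⟨?_, ?_⟩⟩
      · rw [mem_closedBall_zero_iff, norm_zero]
        positivity
      · simp only [mem_iInter]
        rintro q x ⟨hg, hx⟩
        exact absurd ⟨y', q, x, hy', hg, hx⟩ hex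
  obtain ⟨g, hg⟩ := exists_continuous_forall_mem_convex_of_local_const htconv htloc
  have hgM : ∀ y, |g y| ≤ M / m := fun y => by
    have := (hg y).1
    rwa [mem_closedBall_zero_iff, Real.norm_eq_abs] at this
  refine ⟨g, g.continuous, fun y => (hgM y).trans (div_le_self hM.le hm1), fun x => ?_⟩
  have hterm : ∀ q, |f x / m - g (innerSum lam (φ q) x)| ≤
      M / (2 * m ^ 2) + if ¬ Good q x then 2 * M / m else 0 := by
    intro q
    by_cases h : Good q x
    · rw [if_neg (not_not.2 h), add_zero, abs_sub_comm]
      have := (hg (innerSum lam (φ q) x)).2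
      simp only [mem_iInter] at this
      have := this q x ⟨h, rfl⟩
      rwa [Metric.mem_closedBall, Real.dist_eq] at this
    · rw [if_pos h]
      have h1 : |f x / m| ≤ M / m := by
        rw [abs_div, abs_of_pos hm0]
        gcongr
        exact hfM x
      have h2 := abs_sub (f x / m) (g (innerSum lam (φ q) x))
      have h3 := hgM (innerSum lam (φ q) x)
      have h4 : 0 ≤ M / (2 * (m : ℝ) ^ 2) := by positivity
      have h5 : 2 * M / m = M / m + M / m := by ring
      linarith
  have hcard : (Finset.univ.filter fun q => ¬ Good q x).card ≤ 2 * n + 1 := by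
    refine card_uncontrolled_le hC hK (u := 1 + ‖x‖) (by linarith [norm_nonneg x])
      (fun q => 1 + |innerSum lam (φ q) x|) (fun q => hup q x) (hlow x) x G
      (fun j => (hG j).1) _ fun q hq hq' => ?_
    simp only [Finset.mem_filter, Finset.mem_univ, true_and, Good, not_and, not_forall,
      not_not] at hq
    obtain ⟨j, h1, h2, h3⟩ := hq hq'
    exact ⟨j, h1, h2, h3⟩
  have hcard' : ((Finset.univ.filter fun q => ¬ Good q x).card : ℝ) ≤ 2 * n + 1 := by
    exact_mod_cast hcard
  calc |f x - ∑ q, g (innerSum lam (φ q) x)|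
      = |∑ q : Fin m, (f x / m - g (innerSum lam (φ q) x))| := by
        congr 1
        rw [Finset.sum_sub_distrib, Finset.sum_const, Finset.card_univ, Fintype.card_fin,
          nsmul_eq_mul, mul_div_cancel₀ _ hm0.ne']
    _ ≤ ∑ q : Fin m, (M / (2 * m ^ 2) + if ¬ Good q x then 2 * M / m else 0) :=
        (Finset.abs_sum_le_sum_abs _ _).trans (Finset.sum_le_sum fun q _ => hterm q)
    _ = M / (2 * m) + (Finset.univ.filter fun q => ¬ Good q x).card * (2 * M / m) := by
        rw [Finset.sum_add_distrib, Finset.sum_const, Finset.card_univ, Fintype.card_fin,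
          nsmul_eq_mul, ← Finset.sum_filter, Finset.sum_const, nsmul_eq_mul]
        congr 1
        field_simp
    _ ≤ M / (2 * m) + (2 * n + 1) * (2 * M / m) := by gcongr
    _ = (8 * n + 5) / (2 * m) * M := by
        field_simp
        ring

/-- Iterating `exists_outer_reducing` and summing the resulting geometric series of outer
functions gives an exact representation. -/
lemma exists_outer_eq {n m : ℕ} (hm : 4 * n + 3 ≤ m) {lam : Fin n → ℝ}
    {φ : Fin m → ℝ → ℝ} (hφ : ∀ q, Continuous (φ q)) {C : ℝ} (hC : 1 ≤ C)
    (hup : ∀ q x, 1 + |innerSum lam (φ q) x| ≤ C * (1 + ‖x‖))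
    (hlow : ∀ x q q', C * (1 + |innerSum lam (φ q) x|) < 1 + ‖x‖ →
      C * (1 + |innerSum lam (φ q') x|) < 1 + ‖x‖ → q = q')
    (hsep : ∀ R δ : ℝ, 0 < δ → ∃ η > 0, ∃ G, Separates lam φ R δ η G)
    {f : (Fin n → ℝ) → ℝ} (hf : Continuous f) {M : ℝ} (hfM : ∀ x, |f x| ≤ M) :
    ∃ g : ℝ → ℝ, Continuous g ∧ ∀ x, f x = ∑ q, g (innerSum lam (φ q) x) := by
  have hm' : (4 * n + 3 : ℝ) ≤ m := by exact_mod_cast hm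
  have hn : (0 : ℝ) ≤ n := n.cast_nonneg
  have hm0 : (0 : ℝ) < m := by linarith
  set θ : ℝ := (8 * n + 5) / (2 * m) with hθ
  have hθ0 : 0 < θ := by positivity
  have hθ1 : θ < 1 := by
    rw [hθ, div_lt_one (by positivity)]
    linarith
  have hcont : ∀ q, Continuous (innerSum lam (φ q)) := by
    intro q
    have := hφ q
    unfold innerSum
    fun_prop
  set M' : ℝ := max M 1 with hM'
  have hM'0 : 0 < M' := lt_of_lt_of_le one_pos (le_max_right _ _)
  let S : ℕ → Type := fun k => {h : (Fin n → ℝ) → ℝ // Continuous h ∧ ∀ x, |h x| ≤ θ ^ k * M'}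
  have hstep : ∀ k (h : S k), ∃ g : ℝ → ℝ, Continuous g ∧ (∀ t, |g t| ≤ θ ^ k * M') ∧
      ∀ x, |h.1 x - ∑ q, g (innerSum lam (φ q) x)| ≤ θ ^ (k + 1) * M' := by
    intro k h
    obtain ⟨g, h1, h2, h3⟩ := exists_outer_reducing hm hC hup hlow hsep h.2.1
      (M := θ ^ k * M') (by positivity) h.2.2
    refine ⟨g, h1, h2, fun x => (h3 x).trans (le_of_eq ?_)⟩
    rw [← hθ]
    ring
  choose G hG1 hG2 hG3 using hstep
  let F : (k : ℕ) → S k := fun k => Nat.rec (motive := S)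
    ⟨f, hf, fun x => by simpa only [pow_zero, one_mul] using (hfM x).trans (le_max_left M 1)⟩
    (fun k h => ⟨fun x => h.1 x - ∑ q, G k h (innerSum lam (φ q) x), by
      have h1 := h.2.1
      have h2 := hG1 k h
      fun_prop, hG3 k h⟩) k
  have hF0 : (F 0).1 = f := rfl
  have hFs : ∀ k x, (F (k + 1)).1 x = (F k).1 x - ∑ q, G k (F k) (innerSum lam (φ q) x) :=
    fun k x => rfl
  have hsum : Summable fun k : ℕ => θ ^ k * M' :=
    (summable_geometric_of_lt_one hθ0.le hθ1).mul_right _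
  refine ⟨fun t => ∑' k, G k (F k) t,
    continuous_tsum (fun k => hG1 k (F k)) hsum fun k t => hG2 k (F k) t, fun x => ?_⟩
  have hsG : ∀ t, Summable fun k => G k (F k) t := fun t =>
    Summable.of_norm_bounded hsum fun k => hG2 k (F k) t
  have h1 : HasSum (fun k => ∑ q, G k (F k) (innerSum lam (φ q) x))
      (∑ q, ∑' k, G k (F k) (innerSum lam (φ q) x)) :=
    hasSum_sum fun q _ => (hsG _).hasSum
  have h2 : ∀ N, ∑ k ∈ Finset.range N, ∑ q, G k (F k) (innerSum lam (φ q) x) =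
      f x - (F N).1 x := by
    intro N
    induction N with
    | zero => simp [hF0]
    | succ N ih => rw [Finset.sum_range_succ, ih, hFs]; ring
  have h3 : Tendsto (fun N => (F N).1 x) atTop (𝓝 0) :=
    squeeze_zero_norm (fun N => (F N).2.2 x) hsum.tendsto_atTop_zero
  have h4 := h1.tendsto_sum_nat
  simp only [h2] at h4
  have h5 : Tendsto (fun N => f x - (F N).1 x) atTop (𝓝 (f x)) := by
    simpa using h3.const_sub (f x)
  exact tendsto_nhds_unique h5 h4

/-! ### Growth of the inner functions -/

/-- The piecewise linear function of slope `1` on the positive and slope `1 + c` on the negative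
half-line. -/
def kink (c s : ℝ) : ℝ := s + c * min s 0

lemma kink_sub_ge {c s t : ℝ} (hc : 0 ≤ c) (hst : s ≤ t) : t - s ≤ kink c t - kink c s := by
  have : min s 0 ≤ min t 0 := min_le_min_right _ hst
  unfold kink
  nlinarith

lemma kink_sub_le {c s t : ℝ} (hc : 0 ≤ c) (hst : s ≤ t) :
    kink c t - kink c s ≤ (1 + c) * (t - s) := by
  have : min t 0 - min s 0 ≤ t - s := by
    rcases min_cases t 0 with h | h <;> rcases min_cases s 0 with h' | h' <;> linarith
  unfold kink
  nlinarith

lemma continuous_kink (c : ℝ) : Continuous (kink c) := by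
  unfold kink
  fun_prop

section Growth

variable {n m : ℕ} {lam : Fin n → ℝ} {φ : Fin m → ℝ → ℝ}

lemma abs_innerSum_sub_le (hlam : ∀ p, 1 ≤ lam p)
    (hφ : ∀ q s, |φ q s - kink q s| ≤ 1) (q : Fin m) (x : Fin n → ℝ) :
    |innerSum lam (φ q) x - (∑ p, lam p * x p + q * ∑ p, lam p * min (x p) 0)| ≤ ∑ p, lam p := by
  have h : innerSum lam (φ q) x - (∑ p, lam p * x p + q * ∑ p, lam p * min (x p) 0) =
      ∑ p, lam p * (φ q (x p) - kink q (x p)) := by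
    unfold innerSum kink
    rw [Finset.mul_sum, ← Finset.sum_add_distrib, ← Finset.sum_sub_distrib]
    exact Finset.sum_congr rfl fun p _ => by ring
  rw [h]
  refine (Finset.abs_sum_le_sum_abs _ _).trans (Finset.sum_le_sum fun p _ => ?_)
  have h0 : 0 ≤ lam p := zero_le_one.trans (hlam p)
  rw [abs_mul, abs_of_nonneg h0]
  exact mul_le_of_le_one_right h0 (hφ q (x p))

lemma one_add_abs_innerSum_le (hlam : ∀ p, 1 ≤ lam p)
    (hφ : ∀ q s, |φ q s - kink q s| ≤ 1) (q : Fin m) (x : Fin n → ℝ) :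
    1 + |innerSum lam (φ q) x| ≤ (2 * m + 6) * (1 + ∑ p, lam p) * (1 + ‖x‖) := by
  have h0 : ∀ p, 0 ≤ lam p := fun p => zero_le_one.trans (hlam p)
  have hΛ : 0 ≤ ∑ p, lam p := Finset.sum_nonneg fun p _ => h0 p
  have hq : (q : ℝ) ≤ m := by exact_mod_cast q.2.le
  have hq0 : (0 : ℝ) ≤ q := by positivity
  have h1 : |∑ p, lam p * x p| ≤ (∑ p, lam p) * ‖x‖ := by
    rw [Finset.sum_mul]
    refine (Finset.abs_sum_le_sum_abs _ _).trans (Finset.sum_le_sum fun p _ => ?_)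
    rw [abs_mul, abs_of_nonneg (h0 p)]
    exact mul_le_mul_of_nonneg_left (norm_le_pi_norm x p) (h0 p)
  have h2 : |∑ p, lam p * min (x p) 0| ≤ (∑ p, lam p) * ‖x‖ := by
    rw [Finset.sum_mul]
    refine (Finset.abs_sum_le_sum_abs _ _).trans (Finset.sum_le_sum fun p _ => ?_)
    rw [abs_mul, abs_of_nonneg (h0 p)]
    refine mul_le_mul_of_nonneg_left (le_trans ?_ (norm_le_pi_norm x p)) (h0 p)
    rw [Real.norm_eq_abs, abs_of_nonpos (min_le_right _ _)]
    rcases min_cases (x p) 0 with h | h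
    · rw [h.1]; exact neg_le_abs _
    · rw [h.1, neg_zero]; exact abs_nonneg _
  have h3 := abs_innerSum_sub_le hlam hφ q x
  set A := ∑ p, lam p * x p
  set B := ∑ p, lam p * min (x p) 0
  set Λ := ∑ p, lam p
  have h4 : |(q : ℝ) * B| ≤ m * (Λ * ‖x‖) := by
    rw [abs_mul, abs_of_nonneg hq0]
    gcongr
  have h5 : |innerSum lam (φ q) x| ≤ Λ + (Λ * ‖x‖ + m * (Λ * ‖x‖)) := by
    have e : innerSum lam (φ q) x = (innerSum lam (φ q) x - (A + q * B)) + (A + q * B) := by ring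
    rw [e]
    refine (abs_add_le _ _).trans (add_le_add h3 ((abs_add_le _ _).trans (add_le_add h1 h4)))
  have hm : (0 : ℝ) ≤ m := m.cast_nonneg
  have hx : 0 ≤ ‖x‖ := norm_nonneg x
  have := mul_nonneg hΛ hx
  have := mul_nonneg hm this
  have := mul_nonneg hm hΛ
  have := mul_nonneg hm hx
  nlinarith

/-- Two different inner functions cannot both be small at a point far from the origin: up to
bounded errors they are `A + q * B` and `A + q' * B`, where `B ≤ 0` and `A - 2 * B` dominates the
norm of the point. -/
lemma eq_of_innerSum_small (hlam : ∀ p, 1 ≤ lam p)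
    (hφ : ∀ q s, |φ q s - kink q s| ≤ 1) {q q' : Fin m} {x : Fin n → ℝ}
    (hq : (2 * m + 6) * (1 + ∑ p, lam p) * (1 + |innerSum lam (φ q) x|) < 1 + ‖x‖)
    (hq' : (2 * m + 6) * (1 + ∑ p, lam p) * (1 + |innerSum lam (φ q') x|) < 1 + ‖x‖) :
    q = q' := by
  by_contra hne
  have h0 : ∀ p, 0 ≤ lam p := fun p => zero_le_one.trans (hlam p)
  have hΛ : 0 ≤ ∑ p, lam p := Finset.sum_nonneg fun p _ => h0 p
  have hqm : (q : ℝ) ≤ m := by exact_mod_cast q.2.le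
  have hq0 : (0 : ℝ) ≤ q := by positivity
  have h3 := abs_innerSum_sub_le hlam hφ q x
  have h3' := abs_innerSum_sub_le hlam hφ q' x
  have hx : ‖x‖ ≤ ∑ p, lam p * x p - 2 * ∑ p, lam p * min (x p) 0 := by
    have hterm : ∀ p, |x p| ≤ lam p * x p - 2 * (lam p * min (x p) 0) := by
      intro p
      have e : lam p * x p - 2 * (lam p * min (x p) 0) = lam p * |x p| := by
        rcases le_total (x p) 0 with h | h
        · rw [min_eq_left h, abs_of_nonpos h]; ring
        · rw [min_eq_right h, abs_of_nonneg h]; ring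
      rw [e]
      exact le_mul_of_one_le_left (abs_nonneg _) (hlam p)
    rw [Finset.mul_sum, ← Finset.sum_sub_distrib]
    refine (pi_norm_le_iff_of_nonneg
      (Finset.sum_nonneg fun p _ => (abs_nonneg _).trans (hterm p))).2 fun p => ?_
    exact (hterm p).trans (Finset.single_le_sum
      (f := fun p => lam p * x p - 2 * (lam p * min (x p) 0))
      (fun p _ => (abs_nonneg _).trans (hterm p)) (Finset.mem_univ p))
  have hB : ∑ p, lam p * min (x p) 0 ≤ 0 :=
    Finset.sum_nonpos fun p _ => mul_nonpos_of_nonneg_of_nonpos (h0 p) (min_le_right _ _)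
  set A := ∑ p, lam p * x p
  set B := ∑ p, lam p * min (x p) 0
  set Λ := ∑ p, lam p
  set a := |innerSum lam (φ q) x| with ha
  set a' := |innerSum lam (φ q') x| with ha'
  have hB' : -B ≤ a + a' + 2 * Λ := by
    have h1 : (1 : ℝ) ≤ |(q : ℝ) - q'| := by
      have : (q : ℤ) - q' ≠ 0 := by
        intro h
        exact hne (Fin.ext (by omega))
      have := Int.one_le_abs this
      exact_mod_cast this
    have h2 : |((q : ℝ) - q') * B| ≤ a + a' + 2 * Λ := by
      rw [abs_le] at h3 h3'
      have := abs_le.1 ha.ge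
      have := abs_le.1 ha'.ge
      rw [abs_le]
      constructor <;> linarith
    rw [abs_mul, abs_of_nonpos hB] at h2
    nlinarith
  have hA : A ≤ a + Λ + q * (-B) := by
    have := (abs_le.1 h3).1
    have := le_abs_self (innerSum lam (φ q) x)
    linarith
  have ha0 : 0 ≤ a := abs_nonneg _
  have ha0' : 0 ≤ a' := abs_nonneg _
  have hm : (0 : ℝ) ≤ m := m.cast_nonneg
  have h4 : (q : ℝ) * (-B) ≤ m * (a + a' + 2 * Λ) := by
    gcongr
    linarith
  have hx' : 1 + ‖x‖ ≤ 1 + a + Λ + (m + 2) * (a + a' + 2 * Λ) := by linarith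
  have hm1 := mul_nonneg hm ha0
  have hm2 := mul_nonneg hm ha0'
  have hm3 := mul_nonneg hΛ ha0
  have hm4 := mul_nonneg hΛ ha0'
  have hm5 := mul_nonneg hm hm3
  have hm6 := mul_nonneg hm hm4
  have hm7 := mul_nonneg hm hΛ
  nlinarith

end Growth

/-! ### Weights independent over the rationals -/

/-- There are positive weights `lam` and positive numbers `mu` such that the real numbers
`lam p * mu q` are linearly independent over `ℚ`. -/
lemma exists_independent_weights (n m : ℕ) :
    ∃ (lam : Fin n → ℝ) (mu : Fin m → ℝ), (∀ p, 1 ≤ lam p) ∧ (∀ q, 0 < mu q) ∧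
      LinearIndependent ℚ fun i : Fin m × Fin n => lam i.2 * mu i.1 := by
  obtain ⟨x, hx1, hx⟩ : ∃ x : ℝ, 1 < x ∧ Transcendental ℚ x := by
    obtain ⟨x, hx, hx'⟩ := ((Algebraic.countable ℚ ℝ).dense_compl ℝ).inter_open_nonempty
      (Ioi 1) isOpen_Ioi ⟨2, mem_Ioi.2 one_lt_two⟩
    exact ⟨x, hx, hx'⟩
  have hpow : LinearIndependent ℚ fun k : ℕ => x ^ k := by
    have := (Polynomial.basisMonomials ℚ).linearIndependent.map'
      (Polynomial.aeval x : Polynomial ℚ →ₐ[ℚ] ℝ).toLinearMap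
      (LinearMap.ker_eq_bot.2 (transcendental_iff_injective.1 hx))
    have e : (Polynomial.aeval x : Polynomial ℚ →ₐ[ℚ] ℝ).toLinearMap ∘
        Polynomial.basisMonomials ℚ = fun k : ℕ => x ^ k := by
      funext k
      simp [Polynomial.aeval_monomial]
    rw [e] at this
    exact this
  refine ⟨fun p => x ^ (p : ℕ), fun q => x ^ (n * (q : ℕ)), fun p => one_le_pow₀ hx1.le,
    fun q => by positivity, ?_⟩
  have hinj : Function.Injective fun i : Fin m × Fin n => (i.2 : ℕ) + n * (i.1 : ℕ) := by
    rintro ⟨q, p⟩ ⟨q', p'⟩ h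
    simp only at h
    have hn : 0 < n := p.pos
    have h1 := congrArg (· % n) h
    have h2 := congrArg (· / n) h
    simp only [Nat.add_mul_mod_self_left, Nat.mod_eq_of_lt p.2, Nat.mod_eq_of_lt p'.2] at h1
    simp only [Nat.add_mul_div_left _ _ hn, Nat.div_eq_of_lt p.2, Nat.div_eq_of_lt p'.2,
      zero_add] at h2
    exact Prod.ext (Fin.ext h2) (Fin.ext h1)
  convert hpow.comp _ hinj using 2 with i
  simp [pow_add]

/-- If `lam p * mu q` are independent over `ℚ`, a combination of the `lam p` with coefficients in
`mu q * ℚ`, not all zero, determines both `q` and the coefficients. -/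
lemma eq_of_weighted_sum_eq {n m : ℕ} {lam : Fin n → ℝ} {mu : Fin m → ℝ}
    (h : LinearIndependent ℚ fun i : Fin m × Fin n => lam i.2 * mu i.1) {q q' : Fin m}
    {r r' : Fin n → ℚ} (p₀ : Fin n) (hr : r p₀ ≠ 0)
    (e : ∑ p, lam p * (mu q * r p) = ∑ p, lam p * (mu q' * r' p)) : q = q' ∧ r = r' := by
  classical
  have key := Fintype.linearIndependent_iff.1 h
    (fun i => (if i.1 = q then r i.2 else 0) - (if i.1 = q' then r' i.2 else 0)) (by
      rw [Fintype.sum_prod_type_right]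
      rw [← sub_eq_zero, ← Finset.sum_sub_distrib] at e
      rw [← e]
      refine Finset.sum_congr rfl fun p _ => ?_
      simp only [sub_smul, Finset.sum_sub_distrib, ite_smul, zero_smul, Finset.sum_ite_eq',
        Finset.mem_univ, if_true, Rat.smul_def]
      ring)
  have hqq : q = q' := by
    by_contra hne
    have := key (q, p₀)
    simp only [if_true, if_neg hne, sub_zero] at this
    exact hr this
  subst hqq
  refine ⟨rfl, funext fun p => ?_⟩
  have := key (q, p)
  simp only [if_true] at this
  linarith

/-! ### Staircases -/

/-- The continuous interpolation of a sequence `v` on `ℤ` that climbs from `v k` to `v (k + 1)`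
with slope proportional to `c` right after `k`, and stays at `v (k + 1)` from `k + 1 / c` to
`k + 1`. -/
noncomputable def stair (v : ℤ → ℝ) (c r : ℝ) : ℝ :=
  v ⌊r⌋ + min 1 (c * Int.fract r) * (v (⌊r⌋ + 1) - v ⌊r⌋)

section Stair

variable {v : ℤ → ℝ} {c : ℝ}

lemma continuous_stair (hc : 1 ≤ c) : Continuous (stair v c) := by
  rw [continuous_iff_continuousAt]
  intro r₀
  -- Near `r₀` the floor takes at most two values, and the ramps on both sides of `⌊r₀⌋` combine
  -- into one formula because the left one has reached its plateau at `⌊r₀⌋`.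
  have hev : (fun r : ℝ => v ⌊r₀⌋ + min 1 (c * max (r - ⌊r₀⌋) 0) * (v (⌊r₀⌋ + 1) - v ⌊r₀⌋) -
      (1 - min 1 (c * (r - ⌊r₀⌋ + 1))) * (v ⌊r₀⌋ - v (⌊r₀⌋ - 1))) =ᶠ[𝓝 r₀] stair v c := by
    have h1 : (⌊r₀⌋ : ℝ) - 1 < r₀ := by linarith [Int.floor_le r₀]
    filter_upwards [Ioo_mem_nhds h1 (Int.lt_floor_add_one r₀)] with r hr
    set k := ⌊r₀⌋
    unfold stair
    rcases le_or_gt (k : ℝ) r with h | h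
    · have hfl : ⌊r⌋ = k := Int.floor_eq_iff.2 ⟨h, hr.2⟩
      have h2 : min 1 (c * (r - k + 1)) = 1 := min_eq_left (by nlinarith)
      rw [h2, max_eq_left (sub_nonneg.2 h), Int.fract, hfl]
      ring
    · have hfl : ⌊r⌋ = k - 1 :=
        Int.floor_eq_iff.2 ⟨by push_cast; linarith [hr.1], by push_cast; linarith⟩
      rw [max_eq_right (by linarith), Int.fract, hfl, sub_add_cancel]
      push_cast
      rw [show r - ((k : ℝ) - 1) = r - k + 1 by ring, mul_zero, min_eq_right zero_le_one]
      ring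
  refine ContinuousAt.congr ?_ hev
  fun_prop

lemma stair_mem_Icc (hc : 0 ≤ c) (hv : Monotone v) (r : ℝ) :
    stair v c r ∈ Icc (v ⌊r⌋) (v (⌊r⌋ + 1)) := by
  have h1 : v ⌊r⌋ ≤ v (⌊r⌋ + 1) := hv (by omega)
  have h2 : 0 ≤ min 1 (c * Int.fract r) := le_min zero_le_one (mul_nonneg hc (Int.fract_nonneg r))
  have h3 : min 1 (c * Int.fract r) ≤ 1 := min_le_left _ _
  unfold stair
  constructor <;> nlinarith

lemma monotone_stair (hc : 0 ≤ c) (hv : Monotone v) : Monotone (stair v c) := by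
  intro r r' h
  rcases (Int.floor_mono h).eq_or_lt with hfl | hfl
  · have h1 : v ⌊r⌋ ≤ v (⌊r⌋ + 1) := hv (by omega)
    have h2 : min 1 (c * Int.fract r) ≤ min 1 (c * Int.fract r') := by
      refine min_le_min_left _ (mul_le_mul_of_nonneg_left ?_ hc)
      rw [Int.fract, Int.fract, hfl]
      linarith
    unfold stair
    rw [← hfl]
    nlinarith
  · exact (stair_mem_Icc hc hv r).2.trans ((hv (by omega)).trans (stair_mem_Icc hc hv r').1)

lemma stair_eq_of_le_fract (hc : 0 < c) {r : ℝ} (hr : 1 / c ≤ Int.fract r) :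
    stair v c r = v (⌊r⌋ + 1) := by
  have : 1 ≤ c * Int.fract r := by rwa [div_le_iff₀' hc] at hr
  unfold stair
  rw [min_eq_left this]
  ring

end Stair

/-- The gaps of index `q` for the mesh `h`: in each period of length `h`, the `q`-th of `m`
intervals of length `h / m`. -/
def gap (m : ℕ) (h : ℝ) (q : ℕ) : Set ℝ := {s | Int.fract (s / h - q / m) < 1 / m}

lemma gap_disjoint {m : ℕ} {h : ℝ} {q q' : Fin m} {s : ℝ} (hq : s ∈ gap m h q)
    (hq' : s ∈ gap m h q') : q = q' := by
  have hm : (0 : ℝ) < m := by exact_mod_cast q.pos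
  simp only [gap, mem_ofPred_eq, Int.fract] at hq hq'
  rw [lt_div_iff₀ hm] at hq hq'
  have h1 := Int.floor_le (s / h - (q : ℕ) / m)
  have h1' := Int.floor_le (s / h - (q' : ℕ) / m)
  set a := ⌊s / h - (q : ℕ) / (m : ℝ)⌋
  set b := ⌊s / h - (q' : ℕ) / (m : ℝ)⌋
  have e : ((q : ℕ) : ℝ) / m * m = (q : ℕ) := div_mul_cancel₀ _ hm.ne'
  have e' : ((q' : ℕ) : ℝ) / m * m = (q' : ℕ) := div_mul_cancel₀ _ hm.ne'
  have h2 : ((q : ℤ) - q' + m * (a - b) : ℝ) < 1 := by push_cast; nlinarith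
  have h3 : (-1 : ℝ) < ((q : ℤ) - q' + m * (a - b) : ℝ) := by push_cast; nlinarith
  have h4 : (q : ℤ) - q' + m * (a - b) < 1 := by exact_mod_cast h2
  have h5 : -1 < (q : ℤ) - q' + m * (a - b) := by exact_mod_cast h3
  have h6 : (q : ℤ) - q' = m * (b - a) := by linarith
  have h7 : (m : ℤ) ∣ (q : ℤ) - q' := ⟨_, h6⟩
  have h8 : |(q : ℤ) - q'| < m := by
    have := q.2
    have := q'.2
    rw [abs_lt]
    constructor <;> omega
  have := Int.eq_zero_of_abs_lt_dvd h7 h8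
  exact Fin.ext (by omega)

/-- A strictly increasing function is close to staircases that take nonzero values in `μ * ℚ` off
the gaps. -/
lemma exists_staircase {m : ℕ} (hm : 1 ≤ m) (q : ℕ) {φ : ℝ → ℝ} (hφ : StrictMono φ) {h μ : ℝ}
    (hh : 0 < h) (hμ : 0 < μ) :
    ∃ φ' : ℝ → ℝ, Continuous φ' ∧ Monotone φ' ∧
      (∀ s, φ (s - 2 * h) ≤ φ' s ∧ φ' s ≤ φ (s + 2 * h)) ∧
      ∃ r : ℤ → ℚ, StrictMono r ∧ (∀ k, r k ≠ 0) ∧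
        ∀ s, s ∉ gap m h q → φ' s = μ * r ⌊s / h - q / m⌋ := by
  have hm' : (1 : ℝ) ≤ m := by exact_mod_cast hm
  -- The rational `r k` is chosen with `μ * r k` between the values of `φ` at consecutive nodes.
  let t : ℤ → ℝ := fun k => h * (k + q / m)
  have ht : StrictMono t := fun k l hkl => by
    have : (k : ℝ) < l := by exact_mod_cast hkl
    exact mul_lt_mul_of_pos_left (by linarith) hh
  have hr : ∀ k : ℤ, ∃ r : ℚ, φ (t k) / μ < r ∧ r < φ (t (k + 1)) / μ ∧ r ≠ 0 := by
    intro k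
    have hlt : φ (t k) / μ < φ (t (k + 1)) / μ :=
      div_lt_div_of_pos_right (hφ (ht (by omega))) hμ
    rcases le_or_gt (φ (t (k + 1)) / μ) 0 with h0 | h0
    · obtain ⟨r, h1, h2⟩ := exists_rat_btwn hlt
      refine ⟨r, h1, h2, fun h3 => ?_⟩
      rw [h3, Rat.cast_zero] at h2
      linarith
    · obtain ⟨r, h1, h2⟩ := exists_rat_btwn (max_lt hlt h0)
      refine ⟨r, (le_max_left _ _).trans_lt h1, h2, fun h3 => ?_⟩
      rw [h3, Rat.cast_zero] at h1
      exact absurd ((le_max_right _ _).trans_lt h1) (lt_irrefl _)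
  choose r hr1 hr2 hr0 using hr
  have hrm : StrictMono r := strictMono_int_of_lt_succ fun k => by
    have : (r k : ℝ) < r (k + 1) := (hr2 k).trans (hr1 (k + 1))
    exact_mod_cast this
  let v : ℤ → ℝ := fun k => μ * r (k - 1)
  have hv : Monotone v := fun k l hkl => by
    have : r (k - 1) ≤ r (l - 1) := hrm.monotone (by omega)
    exact mul_le_mul_of_nonneg_left (by exact_mod_cast this) hμ.le
  have hv1 : ∀ k, φ (t (k - 1)) ≤ v k := fun k => by
    have := (hr1 (k - 1)).le
    rwa [div_le_iff₀' hμ] at this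
  have hv2 : ∀ k, v k ≤ φ (t k) := fun k => by
    have := (hr2 (k - 1)).le
    rwa [le_div_iff₀' hμ, sub_add_cancel] at this
  have hc0 : (0 : ℝ) ≤ m := by linarith
  refine ⟨fun s => stair v m (s / h - q / m), (continuous_stair hm').comp (by fun_prop),
    (monotone_stair hc0 hv).comp fun s s' hs => by gcongr, fun s => ?_, r, hrm, hr0,
    fun s hs => ?_⟩
  · have h1 := stair_mem_Icc hc0 hv (s / h - q / m)
    have h2 := Int.floor_le (s / h - q / m)
    have h3 := Int.lt_floor_add_one (s / h - q / m)
    set k := ⌊s / h - q / (m : ℝ)⌋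
    have h4 : s = h * (s / h) := by field_simp
    refine ⟨le_trans (hφ.monotone ?_) ((hv1 k).trans h1.1),
      h1.2.trans ((hv2 _).trans (hφ.monotone ?_))⟩
    · simp only [t]
      push_cast
      nlinarith
    · simp only [t]
      push_cast
      nlinarith
  · simp only [gap, mem_ofPred_eq, not_lt] at hs
    show stair v m (s / h - q / m) = _
    rw [stair_eq_of_le_fract (by linarith) hs]
    simp only [v, add_sub_cancel_right]

lemma Set.Finite.exists_pos_forall_eq_of_abs_sub_lt {A : Set ℝ} (hA : A.Finite) :
    ∃ η > 0, ∀ a ∈ A, ∀ b ∈ A, |a - b| < η → a = b := by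
  have hD : (image2 (fun a b : ℝ => a - b) A A \ {0}).Finite := (hA.image2 _ hA).sdiff
  obtain ⟨η, hη, h⟩ := Metric.mem_nhds_iff.1 (hD.isClosed.isOpen_compl.mem_nhds (x := 0) (by simp))
  refine ⟨η, hη, fun a ha b hb hab => ?_⟩
  by_contra hne
  exact h (a := a - b) (by simpa using hab) ⟨mem_image2_of_mem ha hb, sub_ne_zero.2 hne⟩

lemma Separates.mono {n m : ℕ} {lam : Fin n → ℝ} {φ : Fin m → ℝ → ℝ} {R R' δ δ' η : ℝ}
    {G : Fin m → Set ℝ} (h : Separates lam φ R δ η G) (hR : R' ≤ R) (hδ : δ ≤ δ') :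
    Separates lam φ R' δ' η G :=
  ⟨h.1, fun q q' x y hx hy hxy => (h.2 q q' x y (fun p => ⟨(hx p).1.trans hR, (hx p).2⟩)
    (fun p => ⟨(hy p).1.trans hR, (hy p).2⟩) hxy).trans hδ⟩

/-- Staircases with independent sets of values separate: on a bounded cube there are only finitely
many values off the gaps, and by independence each of them determines the cell. -/
lemma exists_separates_of_staircase {n m : ℕ} (hn : 0 < n) {lam : Fin n → ℝ} {mu : Fin m → ℝ}
    (hind : LinearIndependent ℚ fun i : Fin m × Fin n => lam i.2 * mu i.1)
    {φ : Fin m → ℝ → ℝ} {h : ℝ} (hh : 0 < h) {r : Fin m → ℤ → ℚ} (hr : ∀ q, StrictMono (r q))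
    (hr0 : ∀ q k, r q k ≠ 0)
    (hφ : ∀ q : Fin m, ∀ s, s ∉ gap m h q → φ q s = mu q * r q ⌊s / h - (q : ℕ) / m⌋) (R : ℝ) :
    ∃ η > 0, Separates lam φ R h η fun q => gap m h q := by
  have hval : ∀ (q : Fin m) (x : Fin n → ℝ), (∀ p, |x p| ≤ R ∧ x p ∉ gap m h q) →
      innerSum lam (φ q) x = ∑ p, lam p * (mu q * r q ⌊x p / h - (q : ℕ) / m⌋) :=
    fun q x hx => Finset.sum_congr rfl fun p _ => by rw [hφ q _ (hx p).2]
  have hfin : {a | ∃ (q : Fin m) (x : Fin n → ℝ), (∀ p, |x p| ≤ R ∧ x p ∉ gap m h q) ∧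
      innerSum lam (φ q) x = a}.Finite := by
    have hT : (Set.pi univ fun _ : Fin n => Icc (⌊-(R / h) - 1⌋ : ℤ) ⌊R / h⌋).Finite :=
      Set.Finite.pi fun _ => finite_Icc _ _
    refine ((finite_univ (α := Fin m)).image2
      (fun q k => ∑ p, lam p * (mu q * r q (k p))) hT).subset ?_
    rintro a ⟨q, x, hx, rfl⟩
    refine ⟨q, mem_univ q, fun p => ⌊x p / h - (q : ℕ) / m⌋, fun p _ => ⟨?_, ?_⟩,
      (hval q x hx).symm⟩
    · refine Int.floor_mono ?_
      have h1 : ((q : ℕ) : ℝ) / m ≤ 1 := div_le_one_of_le₀ (by exact_mod_cast q.2.le) (by positivity)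
      have h2 : -R / h ≤ x p / h := div_le_div_of_nonneg_right (abs_le.1 (hx p).1).1 hh.le
      rw [neg_div] at h2
      linarith
    · refine Int.floor_mono ?_
      have h1 : 0 ≤ ((q : ℕ) : ℝ) / m := by positivity
      have h2 : x p / h ≤ R / h := div_le_div_of_nonneg_right (abs_le.1 (hx p).1).2 hh.le
      linarith
  obtain ⟨η, hη, hη'⟩ := hfin.exists_pos_forall_eq_of_abs_sub_lt
  refine ⟨η, hη, fun q q' s => gap_disjoint, fun q q' x y hx hy hxy => ?_⟩
  have e := hη' _ ⟨q, x, hx, rfl⟩ _ ⟨q', y, hy, rfl⟩ hxy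
  rw [hval q x hx, hval q' y hy] at e
  obtain ⟨rfl, e'⟩ := eq_of_weighted_sum_eq hind ⟨0, hn⟩ (hr0 q _) e
  refine (dist_pi_le_iff hh.le).2 fun p => ?_
  have hfl := (hr q).injective (congrFun e' p)
  have h1 := Int.abs_sub_lt_one_of_floor_eq_floor hfl
  rw [sub_sub_sub_cancel_right, ← sub_div, abs_div, abs_of_pos hh, div_lt_one hh] at h1
  exact h1.le

/-! ### Generic tuples of inner functions -/

/-- The tuples of continuous nondecreasing functions in which the `q`-th function is within
distance `1` of `kink q`, with the topology of locally uniform convergence. -/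
def kinkTuples (m : ℕ) : Set (Fin m → C(ℝ, ℝ)) :=
  {φ | ∀ q, Monotone (φ q) ∧ ∀ s, |φ q s - kink q s| ≤ 1}

section Tuples

variable {m : ℕ}

lemma isClosed_kinkTuples : IsClosed (kinkTuples m) := by
  have heval : ∀ (q : Fin m) (s : ℝ), Continuous fun φ : Fin m → C(ℝ, ℝ) => φ q s := fun q s =>
    (continuous_eval_const s).comp (continuous_apply q)
  have e : kinkTuples m = ⋂ q : Fin m, ((⋂ s : ℝ, ⋂ t : ℝ, ⋂ (_ : s ≤ t), {φ | φ q s ≤ φ q t}) ∩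
      ⋂ s : ℝ, {φ | |φ q s - kink q s| ≤ 1}) := by
    ext φ
    simp [kinkTuples, Monotone]
  rw [e]
  exact isClosed_iInter fun q => (isClosed_iInter fun s => isClosed_iInter fun t =>
    isClosed_iInter fun _ => isClosed_le (heval q s) (heval q t)).inter
      (isClosed_iInter fun s => isClosed_le (((heval q s).sub continuous_const).abs)
        continuous_const)

instance : BaireSpace (kinkTuples m) :=
  have := (isClosed_kinkTuples (m := m)).isCompletelyPseudoMetrizableSpace
  inferInstance

instance : Nonempty (kinkTuples m) :=
  ⟨⟨fun q => ⟨kink q, continuous_kink _⟩, fun q =>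
    ⟨fun s t hst => by
      have := kink_sub_ge (c := (q : ℕ)) (Nat.cast_nonneg _) hst
      show kink _ s ≤ kink _ t
      linarith, fun s => by simp⟩⟩⟩

lemma eventually_forall_abs_sub_lt (φ : kinkTuples m) (R : ℝ) {ε : ℝ} (hε : 0 < ε) :
    ∀ᶠ φ' in 𝓝 φ, ∀ q s, |s| ≤ R → |φ'.1 q s - φ.1 q s| < ε := by
  rw [eventually_all]
  intro q
  have hcont : Tendsto (fun φ' : kinkTuples m => φ'.1 q) (𝓝 φ) (𝓝 (φ.1 q)) :=
    ((continuous_apply q).comp continuous_subtype_val).tendsto φ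
  have := ContinuousMap.tendsto_iff_forall_isCompact_tendstoUniformlyOn.1 hcont
    (Metric.closedBall 0 R) (isCompact_closedBall 0 R)
  rw [Metric.tendstoUniformlyOn_iff] at this
  filter_upwards [this ε hε] with φ' h s hs
  have := h s (by simpa using hs)
  rwa [dist_comm, Real.dist_eq] at this

lemma dense_of_forall_exists_abs_sub_le {S : Set (kinkTuples m)}
    (h : ∀ (φ : kinkTuples m) (R ε : ℝ), 0 < ε →
      ∃ φ' ∈ S, ∀ q s, |s| ≤ R → |φ'.1 q s - φ.1 q s| ≤ ε) : Dense S := by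
  intro φ
  choose u hu hu' using fun k : ℕ => h φ k (1 / (k + 1)) (by positivity)
  refine mem_closure_of_tendsto (f := u) (b := atTop) ?_ (Eventually.of_forall hu)
  rw [tendsto_subtype_rng, tendsto_pi_nhds]
  intro q
  refine ContinuousMap.tendsto_iff_forall_isCompact_tendstoUniformlyOn.2 fun K hK => ?_
  obtain ⟨R, hR⟩ := hK.isBounded.subset_closedBall 0
  rw [Metric.tendstoUniformlyOn_iff]
  intro ε hε
  filter_upwards [(tendsto_natCast_atTop_atTop (R := ℝ)).eventually_ge_atTop R,
    tendsto_one_div_add_atTop_nhds_zero_nat.eventually_lt_const hε] with k hk hk' s hs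
  have hsR : |s| ≤ R := by simpa using hR hs
  rw [dist_comm, Real.dist_eq]
  exact (hu' k q s (hsR.trans hk)).trans_lt hk'

/-- Mixing a tuple with the model functions makes it strictly increasing, and leaves room for a
further small modification. -/
lemma exists_mix (φ : kinkTuples m) {κ : ℝ} (hκ : 0 ≤ κ) (hκ1 : κ ≤ 1) :
    ∃ φ' : kinkTuples m, (∀ q s t, s ≤ t → κ * (t - s) ≤ φ'.1 q t - φ'.1 q s) ∧
      (∀ q s, |φ'.1 q s - kink q s| ≤ 1 - κ) ∧ ∀ q s, |φ'.1 q s - φ.1 q s| ≤ κ := by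
  let ψ : Fin m → C(ℝ, ℝ) := fun q =>
    ⟨fun s => (1 - κ) * φ.1 q s + κ * kink q s, by
      have := continuous_kink (q : ℕ)
      fun_prop⟩
  have h1 : ∀ q s t, s ≤ t → κ * (t - s) ≤ ψ q t - ψ q s := by
    intro q s t hst
    have h2 := (φ.2 q).1 hst
    have h3 := kink_sub_ge (c := (q : ℕ)) (Nat.cast_nonneg _) hst
    show κ * (t - s) ≤ (1 - κ) * φ.1 q t + κ * kink q t - ((1 - κ) * φ.1 q s + κ * kink q s)
    nlinarith
  have h2 : ∀ q s, |ψ q s - kink q s| ≤ 1 - κ := by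
    intro q s
    have e : ψ q s - kink q s = (1 - κ) * (φ.1 q s - kink q s) := by
      show (1 - κ) * φ.1 q s + κ * kink q s - kink q s = _
      ring
    rw [e, abs_mul, abs_of_nonneg (by linarith)]
    exact mul_le_of_le_one_right (by linarith) ((φ.2 q).2 s)
  refine ⟨⟨ψ, fun q => ⟨fun s t hst => ?_, fun s => (h2 q s).trans (by linarith)⟩⟩, h1, h2,
    fun q s => ?_⟩
  · have := h1 q s t hst
    nlinarith
  · have e : ψ q s - φ.1 q s = κ * -(φ.1 q s - kink q s) := by
      show (1 - κ) * φ.1 q s + κ * kink q s - φ.1 q s = _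
      ring
    show |ψ q s - φ.1 q s| ≤ κ
    rw [e, abs_mul, abs_of_nonneg hκ, abs_neg]
    exact mul_le_of_le_one_right hκ ((φ.2 q).2 s)

/-- The tuples whose members increase by a definite amount over distances at least `1 / (N + 1)`
in `[-N, N]`. -/
def increasingTuples (m N : ℕ) : Set (kinkTuples m) :=
  {φ | ∃ σ > 0, ∀ q (s t : ℝ), |s| ≤ N → |t| ≤ N → s + 1 / ((N : ℝ) + 1) ≤ t →
    φ.1 q s + σ ≤ φ.1 q t}

lemma isOpen_increasingTuples (N : ℕ) : IsOpen (increasingTuples m N) := by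
  rw [isOpen_iff_eventually]
  rintro φ ⟨σ, hσ, h⟩
  filter_upwards [eventually_forall_abs_sub_lt φ N (ε := σ / 4) (by positivity)] with φ' hφ'
  refine ⟨σ / 2, by positivity, fun q s t hs ht hst => ?_⟩
  have h1 := h q s t hs ht hst
  have h2 := abs_lt.1 (hφ' q s hs)
  have h3 := abs_lt.1 (hφ' q t ht)
  linarith

lemma dense_increasingTuples (N : ℕ) : Dense (increasingTuples m N) := by
  refine dense_of_forall_exists_abs_sub_le fun φ R ε hε => ?_
  obtain ⟨φ', h1, -, h3⟩ := exists_mix φ (κ := min ε 1) (by positivity) (min_le_right _ _)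
  refine ⟨φ', ⟨min ε 1 * (1 / ((N : ℝ) + 1)), by positivity, fun q s t _ _ hst => ?_⟩,
    fun q s _ => (h3 q s).trans (min_le_left _ _)⟩
  have h0 : (0 : ℝ) < 1 / ((N : ℝ) + 1) := by positivity
  have h4 := h1 q s t (by linarith)
  have h5 : min ε 1 * (1 / ((N : ℝ) + 1)) ≤ min ε 1 * (t - s) :=
    mul_le_mul_of_nonneg_left (by linarith) (by positivity)
  linarith

/-- The tuples that resolve the points of `[-N, N]ⁿ` off suitable gaps up to `1 / (N + 1)`. -/
def separatingTuples {n : ℕ} (lam : Fin n → ℝ) (m N : ℕ) : Set (kinkTuples m) :=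
  {φ | ∃ η > 0, ∃ G, Separates lam (fun q => φ.1 q) N (1 / ((N : ℝ) + 1)) η G}

variable {n : ℕ} {lam : Fin n → ℝ}

lemma isOpen_separatingTuples (hlam : ∀ p, 0 ≤ lam p) (N : ℕ) :
    IsOpen (separatingTuples lam m N) := by
  rw [isOpen_iff_eventually]
  rintro φ ⟨η, hη, G, hG1, hG2⟩
  have hΛ : 0 ≤ ∑ p, lam p := Finset.sum_nonneg fun p _ => hlam p
  have hpos : 0 < η / (4 * (1 + ∑ p, lam p)) := by positivity
  filter_upwards [eventually_forall_abs_sub_lt φ N hpos] with φ' hφ'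
  refine ⟨η / 2, by positivity, G, hG1, fun q q' x y hx hy hxy => ?_⟩
  have hclose : ∀ (q : Fin m) (x : Fin n → ℝ), (∀ p, |x p| ≤ N) →
      |innerSum lam (φ'.1 q) x - innerSum lam (φ.1 q) x| ≤ η / 4 := by
    intro q x hx
    unfold innerSum
    rw [← Finset.sum_sub_distrib]
    calc |∑ p, (lam p * φ'.1 q (x p) - lam p * φ.1 q (x p))|
        ≤ ∑ p, lam p * (η / (4 * (1 + ∑ p, lam p))) := by
          refine (Finset.abs_sum_le_sum_abs _ _).trans (Finset.sum_le_sum fun p _ => ?_)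
          rw [← mul_sub, abs_mul, abs_of_nonneg (hlam p)]
          exact mul_le_mul_of_nonneg_left (hφ' q _ (hx p)).le (hlam p)
      _ = (∑ p, lam p) / (1 + ∑ p, lam p) * (η / 4) := by
          rw [← Finset.sum_mul]
          field_simp
      _ ≤ 1 * (η / 4) := by
          gcongr
          exact div_le_one_of_le₀ (by linarith) (by linarith)
      _ = η / 4 := one_mul _
  refine hG2 q q' x y hx hy ?_
  have h1 := abs_le.1 (hclose q x fun p => (hx p).1)
  have h2 := abs_le.1 (hclose q' y fun p => (hy p).1)
  rw [abs_lt] at hxy ⊢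
  constructor <;> linarith

lemma dense_separatingTuples (hn : 0 < n) {mu : Fin m → ℝ} (hmu : ∀ q, 0 < mu q)
    (hind : LinearIndependent ℚ fun i : Fin m × Fin n => lam i.2 * mu i.1) (N : ℕ) :
    Dense (separatingTuples lam m N) := by
  refine dense_of_forall_exists_abs_sub_le fun φ R ε hε => ?_
  set κ : ℝ := min (ε / 2) 1 with hκ
  have hκ0 : 0 < κ := by positivity
  obtain ⟨φ₁, h1, h2, h3⟩ := exists_mix φ hκ0.le (min_le_right _ _)
  have hmono : ∀ q, StrictMono (φ₁.1 q) := fun q s t hst => by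
    have := h1 q s t hst.le
    nlinarith
  have hcont : Continuous fun s : ℝ => fun q => φ₁.1 q s := by fun_prop
  have hu := (isCompact_closedBall (0 : ℝ) (R + 1)).uniformContinuousOn_of_continuous
    hcont.continuousOn
  rw [Metric.uniformContinuousOn_iff] at hu
  obtain ⟨δ, hδ, hu⟩ := hu (ε / 2) (by positivity)
  -- The mesh is small for the modulus of continuity, the room left by `exists_mix`, and `N`.
  obtain ⟨h, hh, hh'⟩ := exists_between (show 0 < min (min (δ / 2) (1 / 2))
    (min (κ / (2 * (1 + m))) (1 / ((N : ℝ) + 1))) by positivity)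
  simp only [lt_min_iff] at hh'
  obtain ⟨⟨hhδ, hh2⟩, hhκ, hhN⟩ := hh'
  rw [lt_div_iff₀ (by positivity)] at hhκ
  choose φ' hc hm hb r hr hr0 hv using fun q : Fin m =>
    exists_staircase (m := m) q.pos q (hmono q) hh (hmu q)
  have hmem : (fun q => (⟨φ' q, hc q⟩ : C(ℝ, ℝ))) ∈ kinkTuples m := by
    refine fun q => ⟨hm q, fun s => ?_⟩
    have hq : ((q : ℕ) : ℝ) ≤ m := by exact_mod_cast q.2.le
    have hq0 : (0 : ℝ) ≤ (q : ℕ) := Nat.cast_nonneg _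
    have e1 := kink_sub_le (c := (q : ℕ)) hq0 (show s ≤ s + 2 * h by linarith)
    have e2 := kink_sub_le (c := (q : ℕ)) hq0 (show s - 2 * h ≤ s by linarith)
    have e3 := abs_le.1 (h2 q (s + 2 * h))
    have e4 := abs_le.1 (h2 q (s - 2 * h))
    have e5 := hb q s
    have e6 : (1 + (q : ℕ)) * (2 * h) ≤ κ := by nlinarith
    show |φ' q s - kink q s| ≤ 1
    rw [abs_le]
    constructor <;> nlinarith
  refine ⟨⟨_, hmem⟩, ?_, fun q s hs => ?_⟩
  · obtain ⟨η, hη, hsep⟩ := exists_separates_of_staircase hn hind hh hr hr0 hv N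
    exact ⟨η, hη, _, hsep.mono le_rfl hhN.le⟩
  · show |φ' q s - φ.1 q s| ≤ ε
    have hball : ∀ t, |t - s| ≤ 1 → t ∈ Metric.closedBall (0 : ℝ) (R + 1) := fun t ht => by
      rw [mem_closedBall_zero_iff, Real.norm_eq_abs]
      have := abs_add_le (t - s) s
      rw [sub_add_cancel] at this
      linarith
    have hd : ∀ t, |t - s| ≤ 2 * h → |φ₁.1 q t - φ₁.1 q s| < ε / 2 := fun t ht => by
      have := hu t (hball t (by linarith)) s (hball s (by simp)) (by
        rw [Real.dist_eq]; linarith)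
      exact (dist_le_pi_dist _ _ q).trans_lt this
    have e1 := abs_lt.1 (hd (s + 2 * h) (by simp [abs_of_pos hh]))
    have e2 := abs_lt.1 (hd (s - 2 * h) (by simp [abs_of_pos hh]))
    have e3 := abs_le.1 (h3 q s)
    have e4 := hb q s
    have e5 : κ ≤ ε / 2 := min_le_left _ _
    rw [abs_le]
    constructor <;> linarith

/-- By the Baire category theorem there are strictly increasing functions near the model functions
that separate points at all scales. -/
lemma exists_strictMono_separates (hn : 0 < n) (hlam : ∀ p, 0 ≤ lam p) {mu : Fin m → ℝ}
    (hmu : ∀ q, 0 < mu q)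
    (hind : LinearIndependent ℚ fun i : Fin m × Fin n => lam i.2 * mu i.1) :
    ∃ φ : Fin m → ℝ → ℝ, (∀ q, Continuous (φ q) ∧ StrictMono (φ q)) ∧
      (∀ q s, |φ q s - kink q s| ≤ 1) ∧
      ∀ R δ : ℝ, 0 < δ → ∃ η > 0, ∃ G, Separates lam φ R δ η G := by
  have hdense : Dense (⋂ N, increasingTuples m N ∩ separatingTuples lam m N) :=
    dense_iInter_of_isOpen_nat
      (fun N => (isOpen_increasingTuples N).inter (isOpen_separatingTuples hlam N))
      (fun N => (dense_increasingTuples N).inter_of_isOpen_left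
        (dense_separatingTuples hn hmu hind N) (isOpen_increasingTuples N))
  obtain ⟨φ, hφ⟩ := hdense.nonempty
  rw [mem_iInter] at hφ
  refine ⟨fun q => φ.1 q, fun q => ⟨(φ.1 q).continuous, fun s t hst => ?_⟩,
    fun q s => (φ.2 q).2 s, fun R δ hδ => ?_⟩
  · obtain ⟨N, hN⟩ := exists_nat_gt (max (max |s| |t|) (1 / (t - s)))
    simp only [max_lt_iff] at hN
    obtain ⟨σ, hσ, h⟩ := (hφ N).1
    have h1 : 1 / ((N : ℝ) + 1) ≤ t - s := by
      rw [one_div_le (by positivity) (sub_pos.2 hst)]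
      linarith
    have := h q s t hN.1.1.le hN.1.2.le (by linarith)
    show φ.1 q s < φ.1 q t
    linarith
  · obtain ⟨N, hN⟩ := exists_nat_gt (max R (1 / δ))
    simp only [max_lt_iff] at hN
    obtain ⟨η, hη, G, hG⟩ := (hφ N).2
    refine ⟨η, hη, G, hG.mono hN.1.le ?_⟩
    rw [one_div_le (by positivity) hδ]
    linarith

end Tuples

/-! ### The representation theorem -/

theorem theorem2 (n m : ℕ) (hn : 2 ≤ n)
    (hm : (2 + Real.sqrt 2) * (2 * (n : ℝ) - 1) < (m : ℝ)) :
    ∃ lam : Fin m → Fin n → ℝ, (∀ q p, 0 < lam q p) ∧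
      ∃ φ : Fin m → ℝ → ℝ, (∀ q, Continuous (φ q) ∧ StrictMono (φ q)) ∧
        ∀ f : (Fin n → ℝ) → ℝ, Continuous f → (∃ M : ℝ, ∀ x, |f x| ≤ M) →
          ∃ g : ℝ → ℝ, Continuous g ∧
            ∀ x : Fin n → ℝ, f x = ∑ q : Fin m, g (∑ p : Fin n, lam q p * φ q (x p)) := by
  have hm' : 4 * n + 3 ≤ m := by
    have h2 : (1.4 : ℝ) < Real.sqrt 2 := Real.lt_sqrt_of_sq_lt (by norm_num)
    have hn' : (2 : ℝ) ≤ n := by exact_mod_cast hn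
    have h : (4 * n + 2 : ℝ) < m := by nlinarith
    have : 4 * n + 2 < m := by exact_mod_cast h
    omega
  obtain ⟨lam, mu, hlam, hmu, hind⟩ := exists_independent_weights n m
  have hlam0 : ∀ p, 0 < lam p := fun p => one_pos.trans_le (hlam p)
  obtain ⟨φ, hφ, hkink, hsep⟩ :=
    exists_strictMono_separates (by omega) (fun p => (hlam0 p).le) hmu hind
  refine ⟨fun _ => lam, fun _ => hlam0, φ, hφ, fun f hf ⟨M, hM⟩ => ?_⟩
  have hC : 1 ≤ (2 * (m : ℝ) + 6) * (1 + ∑ p, lam p) := by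
    have h1 : 0 ≤ ∑ p, lam p := Finset.sum_nonneg fun p _ => (hlam0 p).le
    have h2 : (0 : ℝ) ≤ m := m.cast_nonneg
    nlinarith [mul_nonneg h2 h1]
  exact exists_outer_eq hm' (fun q => (hφ q).1) hC (one_add_abs_innerSum_le hlam hkink)
    (fun x q q' => eq_of_innerSum_small hlam hkink) hsep hf hM
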